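/- Let $G$ be a finite group of order $n$, let $C_n$ denote the cyclic group of order $n$, and for a finite group $X$ let $\psi(X)=\sum_{x\in X}o(x)$ be the sum of the orders $o(x)$ of the elements of $X$. If $$\psi(G)>\frac{31}{77}\,\psi(C_n),$$ then $G$ is supersolvable, that is, $G$ has a series $1=H_0\le H_1\le\cdots\le H_k=G$ of subgroups $H_i$, each normal in $G$, such that every factor $H_{i+1}/H_i$ is cyclic. -/

import Mathlib

/-- `psi G` is the sum of the orders of the elements of the finite group `G`. -/
noncomputable def psi (G : Type*) [Group G] : ℕ :=
  ∑ᶠ g : G, orderOf g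

/-- A group `G` is supersolvable if it has a series `1 = H 0 ≤ H 1 ≤ ⋯ ≤ H k = G` of subgroups
that are normal in the whole group `G`, such that every factor `H (i + 1) / H i` is cyclic.
(The terms `H i` with `i > k` play no role.) -/
def IsSupersolvable (G : Type*) [Group G] : Prop :=
  ∃ (k : ℕ) (H : ℕ → Subgroup G) (_ : ∀ i, (H i).Normal),
    H 0 = ⊥ ∧ H k = ⊤ ∧
      ∀ i < k, H i ≤ H (i + 1) ∧ IsCyclic (H (i + 1) ⧸ (H i).subgroupOf (H (i + 1)))

/-! The proof is by induction on `n`. Let `x` have maximal order and let `m` be the index of `⟨x⟩`,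
so `ψ(G) ≤ n² / m`. If a prime `p ∣ n` exceeds `m`, the Sylow `p`-subgroup `P` is cyclic and normal;
then `ψ(G) ≤ ψ(P) ψ(G/P)`, the hypothesis passes to `G/P`, and supersolvability lifts back
(`IsSupersolvable.of_quotient`).

Otherwise all primes dividing `n` are at most `m`, and an Euler product estimate for `ψ(C_n) / n²`
forces `m ≤ 5`. Acting on the cosets of `⟨x⟩` has a cyclic kernel and a small image, which is
supersolvable unless it is `A₄`. In that case counting fixed points gives `ψ(G) ≤ (31/77) ψ(C_n)`, a
contradiction. The constant comes from `ψ(A₄) = 31` and `ψ(C₁₂) = 77`. -/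

/-! ### Order sums of cyclic groups -/

/-- `∑ d ∣ n, d * φ d`, the sum of the element orders of a cyclic group of order `n`. -/
def cyclicPsi (n : ℕ) : ℕ :=
  ∑ d ∈ n.divisors, d * Nat.totient d

lemma psi_eq_sum (G : Type*) [Group G] [Fintype G] : psi G = ∑ g : G, orderOf g :=
  finsum_eq_sum_of_fintype _

lemma psi_of_isCyclic (G : Type*) [Group G] [Finite G] [IsCyclic G] :
    psi G = cyclicPsi (Nat.card G) := by
  classical
  have := Fintype.ofFinite G
  rw [psi_eq_sum, cyclicPsi, Nat.card_eq_fintype_card,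
    ← Finset.sum_fiberwise_of_maps_to (g := fun g : G => orderOf g)
      (t := (Fintype.card G).divisors)
      (fun g _ => Nat.mem_divisors.2 ⟨orderOf_dvd_card, Fintype.card_ne_zero⟩)]
  refine Finset.sum_congr rfl fun d hd => ?_
  rw [← IsCyclic.card_orderOf_eq_totient (α := G) (Nat.dvd_of_mem_divisors hd),
    Finset.sum_congr rfl (g := fun _ => d) (by simp), Finset.sum_const, smul_eq_mul, mul_comm]

lemma cyclicPsi_mul {m n : ℕ} (h : m.Coprime n) :
    cyclicPsi (m * n) = cyclicPsi m * cyclicPsi n := by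
  let f : ArithmeticFunction ℕ := ⟨fun d => d * Nat.totient d, by simp⟩
  have hf : f.IsMultiplicative := by
    refine ⟨by simp [f], fun {a b} hab => ?_⟩
    simp only [f, ArithmeticFunction.coe_mk, Nat.totient_mul hab]
    ring
  have key (k : ℕ) : cyclicPsi k = (f * ArithmeticFunction.zeta) k := by
    rw [ArithmeticFunction.mul_zeta_apply]; rfl
  simp only [key]
  exact (hf.mul ArithmeticFunction.isMultiplicative_zeta).map_mul_of_coprime h

lemma cyclicPsi_prime_pow {p : ℕ} (hp : p.Prime) (k : ℕ) :
    (p + 1) * cyclicPsi (p ^ k) = p * (p ^ k) ^ 2 + 1 := by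
  rw [cyclicPsi, Nat.sum_divisors_prime_pow hp]
  induction k with
  | zero => simp
  | succ k ih =>
    rw [Finset.sum_range_succ, mul_add, ih, Nat.totient_prime_pow_succ hp]
    obtain ⟨q, rfl⟩ : ∃ q, p = q + 1 := ⟨p - 1, by have := hp.pos; omega⟩
    simp only [Nat.add_sub_cancel]
    ring

/-- Both sides are multiplicative, and at a prime power the closed form of `cyclicPsi_prime_pow`
exceeds `p * (p ^ k) ^ 2` by one. -/
lemma sq_le_cyclicPsi_mul_prod (n : ℕ) (hn : n ≠ 0) :
    (n : ℚ) ^ 2 ≤ cyclicPsi n * ∏ p ∈ n.primeFactors, ((p : ℚ) + 1) / p := by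
  induction n using Nat.recOnPosPrimePosCoprime with
  | zero => exact absurd rfl hn
  | one => simp [cyclicPsi]
  | prime_pow p k hp hk =>
    rw [Nat.primeFactors_prime_pow hk.ne' hp, Finset.prod_singleton]
    have h : ((p : ℚ) + 1) * cyclicPsi (p ^ k) = p * (p ^ k) ^ 2 + 1 := by
      exact_mod_cast cyclicPsi_prime_pow hp k
    have hp0 : (0 : ℚ) < p := by exact_mod_cast hp.pos
    rw [mul_div_assoc', le_div_iff₀ hp0]
    push_cast
    linarith
  | coprime a b ha hb hab iha ihb =>
    rw [hab.primeFactors_mul, Finset.prod_union hab.disjoint_primeFactors, cyclicPsi_mul hab]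
    have := mul_le_mul (iha (by omega)) (ihb (by omega)) (by positivity) (by positivity)
    push_cast
    linarith

/-- The primes 2, 3, 5 contribute at most `3/2 * 4/3 * 6/5 = 12/5`. Primes above 6 are replaced by
all integers from 7 to `N`, whose product telescopes. -/
lemma prod_primeFactors_le {n N : ℕ} (hN : 6 ≤ N) (h : ∀ p ∈ n.primeFactors, p ≤ N) :
    ∏ p ∈ n.primeFactors, ((p : ℚ) + 1) / p ≤ 12 / 5 * ((N + 1) / 7) := by
  have hIcc : ∀ N : ℕ, 6 ≤ N → ∏ p ∈ Finset.Ioc 6 N, ((p : ℚ) + 1) / p = (N + 1) / 7 := by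
    intro N hN
    induction N, hN using Nat.le_induction with
    | base => norm_num
    | succ N hN ih =>
      rw [← Finset.insert_Ioc_right_eq_Ioc_add_one (by omega), Finset.prod_insert (by simp), ih]
      have : (N : ℚ) + 1 ≠ 0 := by positivity
      push_cast
      field_simp
  have hdisj : Disjoint ({2, 3, 5} : Finset ℕ) (Finset.Ioc 6 N) := by
    simp [Finset.disjoint_left]
  have hsub : n.primeFactors ⊆ {2, 3, 5} ∪ Finset.Ioc 6 N := by
    intro p hp
    have hpN := h p hp
    have hpp := Nat.prime_of_mem_primeFactors hp
    by_cases h6 : 6 < p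
    · simp [h6, hpN]
    · have : p ≤ 6 := by omega
      interval_cases p <;> revert hpp <;> norm_num
  calc _ ≤ ∏ p ∈ {2, 3, 5} ∪ Finset.Ioc 6 N, ((p : ℚ) + 1) / p := by
        refine Finset.prod_le_prod_of_subset_of_one_le hsub (fun p _ => by positivity) ?_
        intro p hp _
        have : 0 < p := by
          rcases Finset.mem_union.1 hp with h | h
          · simp at h; omega
          · have := (Finset.mem_Ioc.1 h).1; omega
        have : (0 : ℚ) < p := by exact_mod_cast this
        rw [le_div_iff₀ this]
        linarith
    _ = _ := by
        rw [Finset.prod_union hdisj, hIcc N hN]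
        norm_num

/-! ### Supersolvability of extensions and of small groups -/

/-- An elementwise form of cyclicity pulls back along `G → G ⧸ K` without any isomorphism theorem.
-/
lemma Subgroup.isCyclic_quotient_subgroupOf_iff {G : Type*} [Group G] (L M : Subgroup G)
    [L.Normal] :
    IsCyclic (M ⧸ L.subgroupOf M) ↔ ∃ g ∈ M, ∀ x ∈ M, ∃ k : ℤ, (g ^ k)⁻¹ * x ∈ L := by
  constructor
  · rintro ⟨q, hq⟩
    obtain ⟨g, rfl⟩ := QuotientGroup.mk_surjective q
    refine ⟨g, g.2, fun x hx => ?_⟩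
    obtain ⟨k, hk⟩ := hq (QuotientGroup.mk (⟨x, hx⟩ : M))
    refine ⟨k, ?_⟩
    change ((g : M) : M ⧸ L.subgroupOf M) ^ k = _ at hk
    rw [← QuotientGroup.mk_zpow, QuotientGroup.eq] at hk
    simpa [Subgroup.mem_subgroupOf] using hk
  · rintro ⟨g, hg, h⟩
    refine ⟨QuotientGroup.mk (⟨g, hg⟩ : M), fun q => ?_⟩
    obtain ⟨x, rfl⟩ := QuotientGroup.mk_surjective q
    obtain ⟨k, hk⟩ := h x x.2
    refine ⟨k, ?_⟩
    change ((⟨g, hg⟩ : M) : M ⧸ L.subgroupOf M) ^ k = _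
    rw [← QuotientGroup.mk_zpow, QuotientGroup.eq]
    simpa [Subgroup.mem_subgroupOf] using hk

lemma IsSupersolvable.of_subsingleton (G : Type*) [Group G] [Subsingleton G] :
    IsSupersolvable G :=
  ⟨0, fun _ => ⊥, fun _ => inferInstance, rfl, Subsingleton.elim _ _,
    fun i hi => absurd hi (Nat.not_lt_zero i)⟩

/-- An extension of a supersolvable group by a cyclic normal subgroup is supersolvable. -/
lemma IsSupersolvable.of_quotient {G : Type*} [Group G] (K : Subgroup G) [K.Normal] [IsCyclic K]
    (h : IsSupersolvable (G ⧸ K)) : IsSupersolvable G := by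
  obtain ⟨k, H, hN, h0, hk, hs⟩ := h
  let π := QuotientGroup.mk' K
  -- The series is shifted by one: `⊥` is put below the preimages, the first of which is `K`.
  let H' : ℕ → Subgroup G := fun i => Nat.casesOn i ⊥ fun j => (H j).comap π
  have hN' : ∀ i, (H' i).Normal := by
    rintro (_ | i)
    · exact (inferInstance : (⊥ : Subgroup G).Normal)
    · exact (hN i).comap π
  refine ⟨k + 1, H', hN', rfl, ?_, ?_⟩
  · change (H k).comap π = ⊤
    rw [hk, Subgroup.comap_top]
  rintro (_ | i) hi
  · refine ⟨bot_le, ?_⟩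
    refine (@Subgroup.isCyclic_quotient_subgroupOf_iff G _ (H' 0) (H' (0 + 1)) (hN' 0)).2 ?_
    have h1 : H' 1 = K := by
      change (H 0).comap π = K
      rw [h0, MonoidHom.comap_bot, QuotientGroup.ker_mk']
    simp only [zero_add, h1]
    obtain ⟨g, hg⟩ := IsCyclic.exists_generator (α := K)
    refine ⟨g, g.2, fun x hx => ?_⟩
    obtain ⟨j, hj⟩ := hg ⟨x, hx⟩
    refine ⟨j, ?_⟩
    have : (g : G) ^ j = x := by simpa using congrArg Subtype.val hj
    change _ ∈ (⊥ : Subgroup G)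
    simp [this]
  · obtain ⟨hle, hc⟩ := hs i (by omega)
    refine ⟨Subgroup.comap_mono hle, ?_⟩
    have := hN i
    have : (H' (i + 1)).Normal := hN' (i + 1)
    rw [Subgroup.isCyclic_quotient_subgroupOf_iff] at hc ⊢
    obtain ⟨q, hq, h⟩ := hc
    obtain ⟨g, rfl⟩ := QuotientGroup.mk'_surjective K q
    refine ⟨g, hq, fun x hx => ?_⟩
    obtain ⟨j, hj⟩ := h (π x) hx
    refine ⟨j, ?_⟩
    change π _ ∈ H i
    simpa [π] using hj

lemma IsPGroup.isSupersolvable {p : ℕ} [Fact p.Prime] {G : Type*} [Group G] [Finite G]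
    (hG : IsPGroup p G) : IsSupersolvable G := by
  induction hn : Nat.card G using Nat.strong_induction_on generalizing G with
  | _ n ih =>
  rcases subsingleton_or_nontrivial G with h | h
  · exact .of_subsingleton G
  have := hG.center_nontrivial
  obtain ⟨z, hz⟩ := exists_ne (1 : Subgroup.center G)
  let K := Subgroup.zpowers (z : G)
  have hK : K.Normal := by
    refine ⟨fun x hx g => ?_⟩
    have : x ∈ Subgroup.center G := (Subgroup.zpowers_le.2 z.2) hx
    rw [Subgroup.mem_center_iff.1 this g, mul_inv_cancel_right]
    exact hx
  refine .of_quotient K (ih _ ?_ (hG.to_quotient K) rfl)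
  rw [← hn, Subgroup.card_eq_card_quotient_mul_card_subgroup K]
  have : Nontrivial K := (Subgroup.nontrivial_iff_ne_bot K).2 (by simpa [K] using hz)
  exact lt_mul_of_one_lt_right Nat.card_pos Finite.one_lt_card

lemma IsSupersolvable.of_card_le_four {G : Type*} [Group G] [Finite G] (h : Nat.card G ≤ 4) :
    IsSupersolvable G := by
  have h0 : 0 < Nat.card G := Nat.card_pos
  interval_cases hG : Nat.card G
  · exact (IsPGroup.of_card (p := 2) (n := 0) hG).isSupersolvable
  · exact (IsPGroup.of_card (p := 2) (n := 1) hG).isSupersolvable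
  · exact (IsPGroup.of_card (p := 3) (n := 1) hG).isSupersolvable
  · exact (IsPGroup.of_card (p := 2) (n := 2) hG).isSupersolvable

/-! ### Cyclic normal Sylow subgroups -/

lemma Subgroup.zpowers_normal_of_mem {G : Type*} [Group G] (P : Subgroup G) [P.Normal]
    [IsCyclic P] {u : G} (hu : u ∈ P) : (Subgroup.zpowers u).Normal := by
  refine ⟨fun x hx g => ?_⟩
  obtain ⟨m, hm⟩ := MonoidHom.map_cyclic (MulAut.conjNormal (H := P) g).toMonoidHom
  have hxP : x ∈ P := (Subgroup.zpowers_le.2 hu) hx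
  have := congrArg Subtype.val (hm ⟨x, hxP⟩)
  simp at this
  rw [this]
  exact Subgroup.zpow_mem _ hx m

/-- By coprimality each coset `q` has a representative `s q` killed by `orderOf q`. As `⟨u⟩` is
normal in `G` for `u ∈ P`, `s q * u` has order at most `orderOf q * orderOf u`. -/
lemma psi_le_psi_mul_psi_quotient {G : Type*} [Group G] [Finite G] (P : Subgroup G) [P.Normal]
    [IsCyclic P] (hco : (Nat.card P).Coprime P.index) :
    psi G ≤ psi P * psi (G ⧸ P) := by
  classical
  have := Fintype.ofFinite G
  have key (q : G ⧸ P) : ∃ x : G, (x : G ⧸ P) = q ∧ x ^ orderOf q = 1 := by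
    obtain ⟨x, rfl⟩ := QuotientGroup.mk_surjective q
    have hco' : (orderOf (x : G ⧸ P)).Coprime (Nat.card P) :=
      (hco.coprime_dvd_right (orderOf_dvd_natCard _)).symm
    obtain ⟨e, he1, he0⟩ := Nat.chineseRemainder hco' 1 0
    refine ⟨x ^ e, ?_, ?_⟩
    · rw [QuotientGroup.mk_pow, pow_eq_pow_iff_modEq.2 he1, pow_one]
    · obtain ⟨c, rfl⟩ := (Nat.modEq_zero_iff_dvd.1 he0)
      have hx : x ^ orderOf (x : G ⧸ P) ∈ P := by
        rw [← QuotientGroup.eq_one_iff, QuotientGroup.mk_pow, pow_orderOf_eq_one]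
      have : (x ^ orderOf (x : G ⧸ P)) ^ Nat.card P = 1 :=
        congrArg Subtype.val (pow_card_eq_one' (x := (⟨_, hx⟩ : P)))
      rw [← pow_mul, mul_comm, ← mul_assoc, pow_mul, pow_mul, this, one_pow]
  choose s hs hs1 using key
  have hord (q : G ⧸ P) (u : P) : orderOf (s q * u) ≤ orderOf q * orderOf u := by
    have hn := P.zpowers_normal_of_mem u.2
    have hmem : (s q * u) ^ orderOf q ∈ Subgroup.zpowers (u : G) := by
      have hu : ((u : G) : G ⧸ Subgroup.zpowers (u : G)) = 1 :=
        (QuotientGroup.eq_one_iff _).2 (Subgroup.mem_zpowers _)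
      rw [← QuotientGroup.eq_one_iff, QuotientGroup.mk_pow, QuotientGroup.mk_mul, hu, mul_one,
        ← QuotientGroup.mk_pow, hs1, QuotientGroup.mk_one]
    have : orderOf ((s q * u) ^ orderOf q) ∣ orderOf (u : G) := orderOf_dvd_of_mem_zpowers hmem
    rw [Subgroup.orderOf_coe] at this
    refine orderOf_le_of_pow_eq_one (Nat.mul_pos (orderOf_pos q) (orderOf_pos u)) ?_
    rw [pow_mul, orderOf_dvd_iff_pow_eq_one.1 this]
  have hinj : Function.Injective fun z : (G ⧸ P) × P => s z.1 * (z.2 : G) := by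
    rintro ⟨q, u⟩ ⟨q', u'⟩ h
    have hq : q = q' := by
      have := congrArg (fun g : G => (g : G ⧸ P)) h
      simpa [QuotientGroup.mk_mul_of_mem, hs] using this
    subst hq
    simpa using h
  have hbij : Function.Bijective fun z : (G ⧸ P) × P => s z.1 * (z.2 : G) := by
    rw [Fintype.bijective_iff_injective_and_card]
    refine ⟨hinj, ?_⟩
    rw [Fintype.card_prod]
    simp only [← Nat.card_eq_fintype_card]
    exact (Subgroup.card_eq_card_quotient_mul_card_subgroup P).symm
  rw [psi_eq_sum, psi_eq_sum, psi_eq_sum, ← hbij.sum_comp, Fintype.sum_prod_type, mul_comm,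
    Finset.sum_mul_sum]
  exact Finset.sum_le_sum fun q _ => Finset.sum_le_sum fun u _ => hord q u

/-- A Sylow `p`-subgroup contained in a cyclic subgroup of index less than `p` is normal. -/
lemma exists_normal_cyclic_sylow {G : Type*} [Group G] [Finite G] (H : Subgroup G) [IsCyclic H]
    (p : ℕ) [hp : Fact p.Prime] (hH : H.index < p) :
    ∃ P : Sylow p G, (P : Subgroup G).Normal ∧ IsCyclic P := by
  have hidx : ¬ p ∣ H.index := fun h =>
    absurd (Nat.le_of_dvd (Nat.pos_of_ne_zero H.index_ne_zero_of_finite) h) (by omega)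
  obtain ⟨P0⟩ : Nonempty (Sylow p H) := inferInstance
  let P1 : Subgroup G := (P0 : Subgroup H).map H.subtype
  have hcard : Nat.card P1 = p ^ (Nat.card G).factorization p := by
    rw [Subgroup.card_map_of_injective H.subtype_injective, ← H.card_mul_index,
      Nat.factorization_mul Nat.card_pos.ne' H.index_ne_zero_of_finite, Finsupp.add_apply,
      Nat.factorization_eq_zero_of_not_dvd hidx, add_zero, P0.card_eq_multiplicity]
  let P := Sylow.ofCard P1 hcard
  have hP : (P : Subgroup G) = P1 := Sylow.coe_ofCard _ _
  have hle : P1 ≤ H := Subgroup.map_subtype_le _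
  have hcyc : IsCyclic P1 := by
    exact isCyclic_of_injective (Subgroup.inclusion hle) (Subgroup.inclusion_injective hle)
  refine ⟨P, ?_, by rw [hP]; exact hcyc⟩
  -- `H` is abelian, so it normalizes `P`; the number of Sylow subgroups is then at most the index
  -- of `H`, below `p`, hence 1.
  have hHN : H ≤ Subgroup.normalizer (P : Set G) := by
    let := IsCyclic.commGroup (α := H)
    have hP' : (P : Set G) = P1 := congrArg SetLike.coe hP
    rw [hP']
    intro h hh
    rw [Subgroup.mem_normalizer_iff]
    have hc (x : G) (hx : x ∈ H) : h * x * h⁻¹ = x := by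
      have := congrArg Subtype.val (mul_comm (⟨h, hh⟩ : H) ⟨x, hx⟩)
      simp only [Subgroup.coe_mul] at this
      rw [this, mul_inv_cancel_right]
    intro x
    constructor
    · intro hx
      rwa [hc x (hle hx)]
    · intro hx
      have hxH : x ∈ H := by
        have := H.mul_mem (H.mul_mem (H.inv_mem hh) (hle hx)) hh
        simpa [mul_assoc] using this
      rwa [hc x hxH] at hx
  have h1 : Nat.card (Sylow p G) < p := by
    rw [P.card_eq_index_normalizer]
    exact (Nat.le_of_dvd (Nat.pos_of_ne_zero H.index_ne_zero_of_finite)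
      (Subgroup.index_dvd_of_le hHN)).trans_lt hH
  have h2 : Nat.card (Sylow p G) = 1 := by
    have := card_sylow_modEq_one p G
    rwa [Nat.ModEq, Nat.mod_eq_of_lt h1, Nat.mod_eq_of_lt hp.out.one_lt] at this
  have : Subsingleton (Sylow p G) := (Nat.card_eq_one_iff_unique.1 h2).1
  exact P.normal_of_subsingleton

/-! ### Order sums when the quotient is the alternating group of degree four -/

lemma sum_filter_mem_orderOf {G : Type*} [Group G] [Fintype G] (S : Subgroup G)
    [DecidablePred (· ∈ S)] : ∑ g : G, (if g ∈ S then orderOf g else 0) = psi S := by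
  rw [psi_eq_sum, ← Finset.sum_filter, Finset.sum_subtype (p := (· ∈ S)) _ (by simp)]
  exact Finset.sum_congr rfl fun x _ => Subgroup.orderOf_coe x

/-- In `A₄` the identity fixes four points, 3-cycles fix one and double transpositions none; this is
inclusion-exclusion for the cover by point stabilizers and derangements. -/
lemma sum_fixed_points_alternating (σ : Equiv.Perm (Fin 4)) (h : Equiv.Perm.sign σ = 1) :
    (∑ i, if σ i = i then 1 else 0) + (if ∀ i, σ i ≠ i then 1 else 0)
      = 1 + if σ = 1 then 3 else 0 := by
  revert σ; decide

lemma sq_eq_one_of_derangement (σ : Equiv.Perm (Fin 4)) (h : Equiv.Perm.sign σ = 1)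
    (hσ : ∀ i, σ i ≠ i) : σ ^ 2 = 1 := by
  revert σ; decide

lemma card_derangements_alternating :
    (Finset.univ.filter fun σ : Equiv.Perm (Fin 4) =>
      Equiv.Perm.sign σ = 1 ∧ ∀ i, σ i ≠ i).card = 3 := by
  decide

lemma perm_fin_three (σ : Equiv.Perm (Fin 3)) (i : Fin 3) (h : σ i = i) : σ ^ 2 = 1 := by
  revert σ i; decide

lemma perm_fin_four (σ : Equiv.Perm (Fin 4)) (i : Fin 4) (h : σ i = i) :
    σ ^ 2 = 1 ∨ σ ^ 3 = 1 := by
  revert σ i; decide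

set_option maxRecDepth 10000 in
lemma perm_fin_five (σ : Equiv.Perm (Fin 5)) (i : Fin 5) (h : σ i = i) :
    σ ^ 4 = 1 ∨ σ ^ 3 = 1 := by
  revert σ i; decide

/-- The factor 12 is `(2 + 1) * (3 + 1)`, clearing both denominators. -/
lemma cyclicPsi_two_pow_mul_three_pow (i j : ℕ) :
    12 * cyclicPsi (2 ^ i * 3 ^ j) = (2 * (2 ^ i) ^ 2 + 1) * (3 * (3 ^ j) ^ 2 + 1) := by
  rw [cyclicPsi_mul (Nat.Coprime.pow _ _ (by norm_num)), ← cyclicPsi_prime_pow Nat.prime_two,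
    ← cyclicPsi_prime_pow Nat.prime_three]
  ring

/-- For an even kernel order `k`, the crude bound `2 * k` on the orders of the `3 * k` derangements
suffices. It fails for `k = 3`, so odd `k` needs the finer estimate of `cyclicPsi_bound_odd`, sharp
at `k = 1`. -/
lemma cyclicPsi_bound_even (i j : ℕ) (hi : 1 ≤ i) :
    77 * (4 * cyclicPsi (3 * (2 ^ i * 3 ^ j)) + 6 * (2 ^ i * 3 ^ j) ^ 2)
      ≤ 31 * cyclicPsi (12 * (2 ^ i * 3 ^ j)) + 77 * (3 * cyclicPsi (2 ^ i * 3 ^ j)) := by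
  have h1 := cyclicPsi_two_pow_mul_three_pow i j
  have h2 := cyclicPsi_two_pow_mul_three_pow i (j + 1)
  have h3 := cyclicPsi_two_pow_mul_three_pow (i + 2) (j + 1)
  have e2 : 3 * (2 ^ i * 3 ^ j) = 2 ^ i * 3 ^ (j + 1) := by ring
  have e3 : 12 * (2 ^ i * 3 ^ j) = 2 ^ (i + 2) * 3 ^ (j + 1) := by ring
  rw [e2, e3]
  have hA : 2 ≤ 2 ^ i := by simpa using Nat.pow_le_pow_right (n := 2) (by norm_num) hi
  have hB : 1 ≤ 3 ^ j := Nat.one_le_pow _ _ (by norm_num)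
  rw [pow_succ 3 j] at *
  rw [pow_add 2 i 2] at *
  generalize (2 : ℕ) ^ i = A at *
  generalize (3 : ℕ) ^ j = B at *
  zify at *
  have hu : (4 : ℤ) ≤ A ^ 2 := by nlinarith
  have hv : (1 : ℤ) ≤ B ^ 2 := by nlinarith
  nlinarith [mul_le_mul_of_nonneg_right hu (by positivity : (0 : ℤ) ≤ B ^ 2)]

lemma cyclicPsi_bound_odd (j : ℕ) :
    77 * (4 * cyclicPsi (3 * 3 ^ j) + 6 * cyclicPsi (3 ^ j))
      ≤ 31 * cyclicPsi (12 * 3 ^ j) + 77 * (3 * cyclicPsi (3 ^ j)) := by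
  have h1 := cyclicPsi_two_pow_mul_three_pow 0 j
  have h2 := cyclicPsi_two_pow_mul_three_pow 0 (j + 1)
  have h3 := cyclicPsi_two_pow_mul_three_pow 2 (j + 1)
  have e2 : 3 * 3 ^ j = 2 ^ 0 * 3 ^ (j + 1) := by ring
  have e3 : 12 * 3 ^ j = 2 ^ 2 * 3 ^ (j + 1) := by ring
  have e1 : 3 ^ j = 2 ^ 0 * 3 ^ j := by ring
  rw [e2, e3]
  rw [← e1] at h1
  have hB : 1 ≤ 3 ^ j := Nat.one_le_pow _ _ (by norm_num)
  rw [pow_succ 3 j] at *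
  generalize (3 : ℕ) ^ j = B at *
  have hv : 1 ≤ B ^ 2 := Nat.one_le_pow _ _ hB
  nlinarith

/-- The bound for a group whose quotient by a cyclic normal subgroup is the alternating group of
degree four, the preimages of the point stabilizers being cyclic. -/
lemma psi_le_of_range_eq_alternatingGroup {G : Type*} [Group G] [Finite G]
    (φ : G →* Equiv.Perm (Fin 4)) (k : ℕ) (hr : φ.range = alternatingGroup (Fin 4))
    (hk : Nat.card φ.ker = k)
    (hcyc : ∀ i : Fin 4, IsCyclic ((MulAction.stabilizer (Equiv.Perm (Fin 4)) i).comap φ))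
    (hcard : ∀ i : Fin 4, Nat.card ((MulAction.stabilizer (Equiv.Perm (Fin 4)) i).comap φ) = 3 * k)
    (hn : Nat.card G = 12 * k) (hp : ∀ p, p.Prime → p ∣ k → p = 2 ∨ p = 3) :
    77 * psi G ≤ 31 * cyclicPsi (12 * k) := by
  classical
  have := Fintype.ofFinite G
  set S : Fin 4 → Subgroup G := fun i => (MulAction.stabilizer (Equiv.Perm (Fin 4)) i).comap φ
    with hSdef
  have hS (i : Fin 4) (g : G) : g ∈ S i ↔ φ g i = i := Iff.rfl
  have hsign (g : G) : Equiv.Perm.sign (φ g) = 1 := by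
    rw [← Equiv.Perm.mem_alternatingGroup, ← hr]
    exact ⟨g, rfl⟩
  have hk0 : 0 < k := hk ▸ Nat.card_pos
  have hkerS (i : Fin 4) : φ.ker ≤ S i := fun g hg => by
    rw [hS, MonoidHom.mem_ker.1 hg]; rfl
  have hKcyc : IsCyclic φ.ker :=
    isCyclic_of_injective (Subgroup.inclusion (hkerS 0)) (Subgroup.inclusion_injective _)
  let D : Finset G := Finset.univ.filter fun g => ∀ i, φ g i ≠ i
  have hsum (w : G → ℕ) : ∑ g, w g + 3 * ∑ g, (if g ∈ φ.ker then w g else 0)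
      = ∑ i, ∑ g, (if g ∈ S i then w g else 0) + ∑ g ∈ D, w g := by
    rw [Finset.sum_comm, Finset.sum_filter, Finset.mul_sum, ← Finset.sum_add_distrib,
      ← Finset.sum_add_distrib]
    refine Finset.sum_congr rfl fun g _ => ?_
    have := congrArg (· * w g) (sum_fixed_points_alternating (φ g) (hsign g))
    simp only [add_mul, Finset.sum_mul, ite_mul, one_mul, zero_mul] at this
    simp only [hS, MonoidHom.mem_ker, mul_ite, mul_zero]
    exact this.symm
  have hDcard : D.card = 3 * k := by
    have hc (T : Subgroup G) [DecidablePred (· ∈ T)] :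
        ∑ g : G, (if g ∈ T then 1 else 0) = Nat.card T := by
      rw [Finset.sum_boole, Nat.cast_id, Nat.card_eq_fintype_card, Fintype.card_subtype]
    have h1 := hsum fun _ => 1
    simp only [hc, hcard, hSdef, hk, Finset.sum_const, Finset.card_univ, smul_eq_mul, mul_one,
      Nat.card_fin, ← Nat.card_eq_fintype_card, hn] at h1
    omega
  have hpsi : psi G + 3 * cyclicPsi k = 4 * cyclicPsi (3 * k) + ∑ g ∈ D, orderOf g := by
    have h1 := hsum fun g => orderOf g
    have h2 (i : Fin 4) : psi (S i) = cyclicPsi (3 * k) := by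
      have := hcyc i
      rw [psi_of_isCyclic (S i), hcard]
    simp only [sum_filter_mem_orderOf, h2, psi_of_isCyclic φ.ker, hk, Finset.sum_const,
      Finset.card_univ, Fintype.card_fin, smul_eq_mul, ← psi_eq_sum] at h1
    exact h1
  have hsq (g : G) (hg : g ∈ D) : g ^ 2 ∈ φ.ker := by
    rw [MonoidHom.mem_ker, map_pow]
    exact sq_eq_one_of_derangement _ (hsign g) (Finset.mem_filter.1 hg).2
  obtain ⟨i, m, hm, rfl⟩ := Nat.exists_eq_two_pow_mul_odd hk0.ne'
  obtain ⟨j, rfl⟩ : ∃ j, m = 3 ^ j := by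
    refine ⟨_, Nat.eq_prime_pow_of_unique_prime_dvd hm.pos.ne' fun {d} hd hdm => ?_⟩
    rcases hp d hd (hdm.mul_left _) with rfl | rfl
    · exact absurd (even_iff_two_dvd.2 hdm) (Nat.not_even_iff_odd.2 hm)
    · rfl
  rcases Nat.eq_zero_or_pos i with rfl | hi
  · simp only [pow_zero, one_mul] at *
    have hle : ∑ g ∈ D, orderOf g ≤ 6 * cyclicPsi (3 ^ j) := by
      -- Elements outside `D` share a cyclic stabilizer preimage with the kernel, so the centralizer
      -- contains 9/12 of `G`, more than half.
      have hcentral : Subgroup.centralizer (φ.ker : Set G) = ⊤ := by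
        have hcompl (g : G) (hg : g ∉ D) : g ∈ Subgroup.centralizer (φ.ker : Set G) := by
          simp only [D, Finset.mem_filter, Finset.mem_univ, true_and, not_forall, not_not] at hg
          obtain ⟨a, ha⟩ := hg
          rw [Subgroup.mem_centralizer_iff]
          intro z hz
          have := hcyc a
          let := IsCyclic.commGroup (α := S a)
          exact congrArg Subtype.val (mul_comm (⟨z, hkerS a hz⟩ : S a) ⟨g, ha⟩)
        have h1 : 9 * 3 ^ j ≤ Nat.card (Subgroup.centralizer (φ.ker : Set G)) := by
          rw [Nat.card_eq_fintype_card, Fintype.card_subtype]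
          calc 9 * 3 ^ j = (Dᶜ).card := by
                rw [Finset.card_compl, hDcard, ← Nat.card_eq_fintype_card, hn]; omega
            _ ≤ _ := Finset.card_le_card fun g hg =>
                Finset.mem_filter.2 ⟨Finset.mem_univ _, hcompl g (Finset.mem_compl.1 hg)⟩
        rw [← Subgroup.index_eq_one]
        have h2 := (Subgroup.centralizer (φ.ker : Set G)).card_mul_index
        have h3 : (Subgroup.centralizer (φ.ker : Set G)).index ≠ 0 :=
          Subgroup.index_ne_zero_of_finite
        rw [hn] at h2
        by_contra h4
        have : 2 ≤ (Subgroup.centralizer (φ.ker : Set G)).index := by omega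
        nlinarith
      have hcomm (z : G) (hz : z ∈ φ.ker) (g : G) : z * g = g * z :=
        Subgroup.mem_centralizer_iff.1 (hcentral ▸ Subgroup.mem_top g) z hz
      -- Two elements with the same image and the same square differ by a central involution or 1 in
      -- a kernel of odd order, so they agree.
      have hfib (z : G) : (D.filter fun g => g ^ 2 = z).card ≤ 3 := by
        rw [← card_derangements_alternating]
        refine Finset.card_le_card_of_injOn φ ?_ ?_
        · intro g hg
          simp only [D, Finset.coe_filter, Finset.mem_filter, Finset.mem_univ, true_and,
            Set.mem_ofPred_eq] at hg ⊢
          exact ⟨hsign g, hg.1⟩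
        · intro g hg g' hg' h
          have hg2 : g ^ 2 = z := (Finset.mem_filter.1 hg).2
          have hg2' : g' ^ 2 = z := (Finset.mem_filter.1 hg').2
          have hc : g⁻¹ * g' ∈ φ.ker := by
            rw [MonoidHom.mem_ker, map_mul, map_inv, h, inv_mul_cancel]
          have h1 : (g⁻¹ * g') ^ 2 = 1 := by
            have h2 : (g * (g⁻¹ * g')) ^ 2 = g ^ 2 * (g⁻¹ * g') ^ 2 :=
              Commute.mul_pow (hcomm _ hc g).symm 2
            rw [mul_inv_cancel_left, hg2', hg2] at h2
            exact left_eq_mul.1 h2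
          have h3 : (g⁻¹ * g') ^ (3 ^ j) = 1 := by
            rw [← hk]
            exact congrArg Subtype.val (pow_card_eq_one' (x := (⟨_, hc⟩ : φ.ker)))
          have h4 : (g⁻¹ * g') = 1 := by
            have := Nat.dvd_gcd (orderOf_dvd_of_pow_eq_one h1) (orderOf_dvd_of_pow_eq_one h3)
            rwa [Nat.Coprime.gcd_eq_one (Nat.Coprime.pow_right j (by norm_num)), Nat.dvd_one,
              orderOf_eq_one_iff] at this
          exact (inv_mul_eq_one.1 h4)
      calc ∑ g ∈ D, orderOf g ≤ ∑ g ∈ D, 2 * orderOf (g ^ 2) := by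
            refine Finset.sum_le_sum fun g _ => orderOf_le_of_pow_eq_one
              (Nat.mul_pos two_pos (orderOf_pos _)) ?_
            rw [pow_mul, pow_orderOf_eq_one]
        _ = ∑ z ∈ Finset.univ.filter (· ∈ φ.ker), ∑ g ∈ D with g ^ 2 = z,
              2 * orderOf (g ^ 2) :=
            (Finset.sum_fiberwise_of_maps_to
              (fun g hg => Finset.mem_filter.2 ⟨Finset.mem_univ _, hsq g hg⟩) _).symm
        _ ≤ ∑ z ∈ Finset.univ.filter (· ∈ φ.ker), 6 * orderOf z := by
            refine Finset.sum_le_sum fun z _ => ?_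
            rw [Finset.sum_congr rfl (g := fun _ => 2 * orderOf z)
              (fun g hg => by rw [(Finset.mem_filter.1 hg).2]), Finset.sum_const, smul_eq_mul]
            calc _ ≤ 3 * (2 * orderOf z) := Nat.mul_le_mul_right _ (hfib z)
              _ = _ := by ring
        _ = 6 * cyclicPsi (3 ^ j) := by
            rw [← Finset.mul_sum, Finset.sum_filter, sum_filter_mem_orderOf,
              psi_of_isCyclic φ.ker, hk]
    have := cyclicPsi_bound_odd j
    omega
  · have hle : ∑ g ∈ D, orderOf g ≤ 6 * (2 ^ i * 3 ^ j) ^ 2 := by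
      calc ∑ g ∈ D, orderOf g ≤ D.card • (2 * (2 ^ i * 3 ^ j)) := by
            refine Finset.sum_le_card_nsmul _ _ _ fun g hg => ?_
            refine orderOf_le_of_pow_eq_one (by positivity) ?_
            rw [pow_mul, ← hk]
            exact congrArg Subtype.val (pow_card_eq_one' (x := (⟨_, hsq g hg⟩ : φ.ker)))
        _ = _ := by rw [hDcard, smul_eq_mul]; ring
    have := cyclicPsi_bound_even i j hi
    omega

/-! ### The action on the cosets of a cyclic subgroup -/

/-- The permutation representation of `G` on the cosets of a cyclic subgroup of index `m`. -/
lemma exists_permutation_hom {G : Type*} [Group G] [Finite G] (x : G) (m : ℕ)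
    (hm : (Subgroup.zpowers x).index = m) :
    ∃ φ : G →* Equiv.Perm (Fin m), IsCyclic φ.ker ∧ φ.ker.index = orderOf (φ x) * m ∧
      (∃ i, φ x i = i) ∧
      ∀ i : Fin m, IsCyclic ((MulAction.stabilizer (Equiv.Perm (Fin m)) i).comap φ) ∧
        Nat.card ((MulAction.stabilizer (Equiv.Perm (Fin m)) i).comap φ) = orderOf x := by
  set H := Subgroup.zpowers x with hH
  have hm' : Nat.card (G ⧸ H) = m := hm
  let e : G ⧸ H ≃ Fin m := Finite.equivFinOfCardEq hm'
  let φ : G →* Equiv.Perm (Fin m) :=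
    e.permCongrHom.toMonoidHom.comp (MulAction.toPermHom G (G ⧸ H))
  have hφ (g : G) (i : Fin m) : φ g i = e (g • e.symm i) := rfl
  have hstab (i : Fin m) : (MulAction.stabilizer (Equiv.Perm (Fin m)) i).comap φ
      = MulAction.stabilizer G (e.symm i) := by
    ext g
    change φ g i = i ↔ g • e.symm i = e.symm i
    rw [hφ, ← Equiv.eq_symm_apply]
  have hconj (i : Fin m) : ∃ g : G, (MulAction.stabilizer (Equiv.Perm (Fin m)) i).comap φ
      = H.map (MulAut.conj g).toMonoidHom := by
    obtain ⟨g, hg⟩ := QuotientGroup.mk_surjective (e.symm i)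
    refine ⟨g, ?_⟩
    have : e.symm i = g • ((1 : G) : G ⧸ H) := by
      rw [MulAction.Quotient.smul_coe, smul_eq_mul, mul_one, hg]
    rw [hstab, this, MulAction.stabilizer_smul_eq_stabilizer_map_conj,
      MulAction.stabilizer_quotient]
  have hker : φ.ker ≤ H := by
    intro g hg
    rw [← MulAction.stabilizer_quotient H, ← e.symm_apply_apply ((1 : G) : G ⧸ H), ← hstab]
    change φ g _ = _
    rw [MonoidHom.mem_ker.1 hg]; rfl
  have hHc : IsCyclic H := inferInstance
  refine ⟨φ, isCyclic_of_injective (Subgroup.inclusion hker) (Subgroup.inclusion_injective _),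
    ?_, ⟨e ((1 : G) : G ⧸ H), ?_⟩, fun i => ?_⟩
  · rw [← Subgroup.relIndex_mul_index hker, Subgroup.relIndex_ker, hm, hH, MonoidHom.map_zpowers,
      Nat.card_zpowers]
  · rw [hφ, e.symm_apply_apply, MulAction.Quotient.smul_coe, smul_eq_mul, mul_one]
    congr 1
    rw [eq_comm, QuotientGroup.eq]
    simp [hH]
  · obtain ⟨g, hg⟩ := hconj i
    have hinj : Function.Injective (MulAut.conj g).toMonoidHom := (MulAut.conj g).injective
    rw [hg]
    refine ⟨(H.equivMapOfInjective _ hinj).isCyclic.1 hHc, ?_⟩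
    rw [Subgroup.card_map_of_injective hinj, hH, Nat.card_zpowers]

/-- The number of Sylow `p`-subgroups divides `d < p`, so it is 1; the quotient by that subgroup has
order at most 4. -/
lemma IsSupersolvable.of_card_eq_prime_mul {G : Type*} [Group G] [Finite G] {p d : ℕ}
    (hp : p.Prime) (hd : d < p) (hd4 : d ≤ 4) (h : Nat.card G = p * d) : IsSupersolvable G := by
  have := Fact.mk hp
  have hd0 : d ≠ 0 := by
    rintro rfl
    exact Nat.card_pos.ne' h
  obtain ⟨P⟩ : Nonempty (Sylow p G) := inferInstance
  have hP : Nat.card P = p := by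
    rw [P.card_eq_multiplicity, h, Nat.factorization_mul hp.ne_zero hd0, Finsupp.add_apply,
      hp.factorization_self, Nat.factorization_eq_zero_of_lt hd, pow_one]
  have hidx : (P : Subgroup G).index = d := by
    have := (P : Subgroup G).card_mul_index
    rw [h] at this
    erw [hP] at this
    exact Nat.eq_of_mul_eq_mul_left hp.pos this
  have h1 : Nat.card (Sylow p G) ≤ d := Nat.le_of_dvd (by omega) (hidx ▸ P.card_dvd_index)
  have h2 : Nat.card (Sylow p G) = 1 := by
    have := card_sylow_modEq_one p G
    rwa [Nat.ModEq, Nat.mod_eq_of_lt (by omega), Nat.mod_eq_of_lt hp.one_lt] at this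
  have : Subsingleton (Sylow p G) := (Nat.card_eq_one_iff_unique.1 h2).1
  have := P.normal_of_subsingleton
  have : IsCyclic (P : Subgroup G) := isCyclic_of_prime_card hP
  refine .of_quotient (P : Subgroup G) (.of_card_le_four ?_)
  change (P : Subgroup G).index ≤ 4
  omega

/-- A group with a cyclic subgroup of index at most five is supersolvable, unless the index is
four and the core has index twelve. -/
lemma supersolvable_or_of_index_le_five {G : Type*} [Group G] [Finite G] (x : G)
    (h5 : (Subgroup.zpowers x).index ≤ 5) :
    IsSupersolvable G ∨ ((Subgroup.zpowers x).index = 4 ∧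
      ∃ φ : G →* Equiv.Perm (Fin 4), φ.ker.index = 12 ∧
        ∀ i : Fin 4, IsCyclic ((MulAction.stabilizer (Equiv.Perm (Fin 4)) i).comap φ) ∧
          Nat.card ((MulAction.stabilizer (Equiv.Perm (Fin 4)) i).comap φ) = orderOf x) := by
  have h0 : 0 < (Subgroup.zpowers x).index :=
    Nat.pos_of_ne_zero Subgroup.index_ne_zero_of_finite
  obtain ⟨φ, hcyc, hidx, ⟨i, hi⟩, hS⟩ := exists_permutation_hom x _ rfl
  have hcard : Nat.card (G ⧸ φ.ker) = orderOf (φ x) * (Subgroup.zpowers x).index := hidx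
  generalize (Subgroup.zpowers x).index = m at *
  interval_cases m
  · left
    refine .of_quotient φ.ker (.of_card_le_four ?_)
    rw [hcard, Subsingleton.elim (φ x) 1, orderOf_one]
    norm_num
  · left
    refine .of_quotient φ.ker (.of_card_le_four ?_)
    have : orderOf (φ x) ≤ 2 := Nat.le_of_dvd two_pos (by
      have := orderOf_dvd_natCard (φ x)
      rwa [Nat.card_perm, Nat.card_fin] at this)
    omega
  · left
    have : orderOf (φ x) ≤ 2 := orderOf_le_of_pow_eq_one two_pos (perm_fin_three _ i hi)
    exact .of_quotient φ.ker (.of_card_eq_prime_mul Nat.prime_three (d := orderOf (φ x))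
      (by omega) (by omega) (by rw [hcard, mul_comm]))
  -- If `φ x` has order 1 or 2, the image is a 2-group; order 3 gives an image of order 12.
  · rcases perm_fin_four _ i hi with h | h
    · left
      have : Fact (Nat.Prime 2) := ⟨Nat.prime_two⟩
      obtain ⟨k, -, hk⟩ := (Nat.dvd_prime_pow Nat.prime_two (m := 1)).1
        (orderOf_dvd_of_pow_eq_one h)
      refine .of_quotient φ.ker (IsPGroup.of_card (p := 2) (n := k + 2) ?_).isSupersolvable
      rw [hcard, hk, pow_add]
      rfl
    · have h3 := orderOf_dvd_of_pow_eq_one h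
      rcases (Nat.dvd_prime Nat.prime_three).1 h3 with h1 | h1
      · left
        refine .of_quotient φ.ker (.of_card_le_four ?_)
        rw [hcard, h1]
      · right
        exact ⟨rfl, φ, by rw [hidx, h1], hS⟩
  · left
    have : orderOf (φ x) ≤ 4 := by
      rcases perm_fin_five _ i hi with h | h
      · exact orderOf_le_of_pow_eq_one (by norm_num) h
      · exact (orderOf_le_of_pow_eq_one (by norm_num) h).trans (by norm_num)
    exact .of_quotient φ.ker (.of_card_eq_prime_mul Nat.prime_five (d := orderOf (φ x))
      (by omega) (by omega) (by rw [hcard, mul_comm]))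

lemma psi_le_of_index_eq_four {G : Type*} [Group G] [Finite G] (x : G)
    (h4 : (Subgroup.zpowers x).index = 4) (φ : G →* Equiv.Perm (Fin 4))
    (hidx : φ.ker.index = 12)
    (hS : ∀ i : Fin 4, IsCyclic ((MulAction.stabilizer (Equiv.Perm (Fin 4)) i).comap φ) ∧
      Nat.card ((MulAction.stabilizer (Equiv.Perm (Fin 4)) i).comap φ) = orderOf x)
    (hp : ∀ p, p.Prime → p ∣ Nat.card G → p = 2 ∨ p = 3) :
    77 * psi G ≤ 31 * cyclicPsi (Nat.card G) := by
  have hr : φ.range = alternatingGroup (Fin 4) := by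
    refine Equiv.Perm.eq_alternatingGroup_of_index_eq_two ?_
    have h1 := φ.range.card_mul_index
    rw [← Subgroup.index_ker, hidx, Nat.card_perm, Nat.card_fin] at h1
    simp [Nat.factorial] at h1
    omega
  have hn := φ.ker.card_mul_index
  have hx := (Subgroup.zpowers x).card_mul_index
  rw [hidx] at hn
  rw [h4, Nat.card_zpowers] at hx
  have h12 : Nat.card G = 12 * Nat.card φ.ker := by omega
  rw [h12]
  refine psi_le_of_range_eq_alternatingGroup φ _ hr rfl (fun i => (hS i).1) (fun i => ?_) h12
    fun p hpp hd => hp p hpp (h12 ▸ hd.mul_left 12)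
  rw [(hS i).2]
  omega

/-! ### Bounding the index, and the induction -/

lemma exists_card_mul_orderOf_ge (G : Type*) [Group G] [Finite G] :
    ∃ x : G, psi G ≤ Nat.card G * orderOf x := by
  have := Fintype.ofFinite G
  obtain ⟨x, hx⟩ := Finite.exists_max fun g : G => orderOf g
  refine ⟨x, ?_⟩
  rw [psi_eq_sum, Nat.card_eq_fintype_card, ← smul_eq_mul]
  exact Finset.sum_le_card_nsmul _ _ _ fun g _ => hx g

lemma cyclicPsi_pos {n : ℕ} (hn : n ≠ 0) : 0 < cyclicPsi n :=
  Finset.sum_pos' (fun _ _ => Nat.zero_le _) ⟨1, by simp [hn], by simp⟩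

/-- The constants are `1085 = 31 * 35` and `924 = 77 * 12`, from the Euler product bound `12 / 35 *
(N + 1)`. -/
lemma index_lt_of_psi_gt {G : Type*} [Group G] [Finite G] (x : G)
    (hx : psi G ≤ Nat.card G * orderOf x)
    (h : 31 * cyclicPsi (Nat.card G) < 77 * psi G) (N : ℕ) (hN : 6 ≤ N)
    (hp : ∀ p ∈ (Nat.card G).primeFactors, p ≤ N) :
    1085 * (Subgroup.zpowers x).index < 924 * (N + 1) := by
  have hn0 : Nat.card G ≠ 0 := Nat.card_pos.ne'
  have h1 := (sq_le_cyclicPsi_mul_prod _ hn0).trans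
    (mul_le_mul_of_nonneg_left (prod_primeFactors_le hN hp) (Nat.cast_nonneg _))
  have h2 := (Subgroup.zpowers x).card_mul_index
  rw [Nat.card_zpowers] at h2
  have hm : 0 < (Subgroup.zpowers x).index := Nat.pos_of_ne_zero Subgroup.index_ne_zero_of_finite
  have hF := cyclicPsi_pos hn0
  have h3 : 31 * cyclicPsi (Nat.card G) * (Subgroup.zpowers x).index < 77 * Nat.card G ^ 2 := by
    calc _ < 77 * (Nat.card G * orderOf x) * (Subgroup.zpowers x).index :=
          Nat.mul_lt_mul_of_pos_right (by omega) hm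
      _ = 77 * (Nat.card G * (orderOf x * (Subgroup.zpowers x).index)) := by ring
      _ = _ := by rw [h2, sq]
  have h4 : (31 * cyclicPsi (Nat.card G) * (Subgroup.zpowers x).index : ℚ)
      < 77 * (Nat.card G : ℚ) ^ 2 := by exact_mod_cast h3
  have h5 : (1085 * (Subgroup.zpowers x).index : ℚ) < 924 * (N + 1) := by
    have hF' : (0 : ℚ) < cyclicPsi (Nat.card G) := by exact_mod_cast hF
    refine lt_of_mul_lt_mul_left ?_ hF'.le
    linarith
  exact_mod_cast h5

theorem isSupersolvable_of_psi_gt {G : Type*} [Group G] [Finite G]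
    (h : 31 * cyclicPsi (Nat.card G) < 77 * psi G) : IsSupersolvable G := by
  induction hn : Nat.card G using Nat.strong_induction_on generalizing G with
  | _ n ih =>
  obtain ⟨x, hx⟩ := exists_card_mul_orderOf_ge G
  by_cases hcase : ∃ p ∈ (Nat.card G).primeFactors, (Subgroup.zpowers x).index < p
  · obtain ⟨p, hp, hlt⟩ := hcase
    have hpp := Nat.prime_of_mem_primeFactors hp
    have := Fact.mk hpp
    obtain ⟨P, hPn, hPc⟩ := exists_normal_cyclic_sylow (Subgroup.zpowers x) p hlt
    have hco : (Nat.card (P : Subgroup G)).Coprime (P : Subgroup G).index := P.card_coprime_index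
    have hcard := (P : Subgroup G).card_mul_index
    have hpsi := psi_le_psi_mul_psi_quotient (P : Subgroup G) hco
    have hP0 : 0 < cyclicPsi (Nat.card (P : Subgroup G)) := cyclicPsi_pos Nat.card_pos.ne'
    refine .of_quotient (P : Subgroup G) (ih _ ?_ ?_ rfl)
    · change (P : Subgroup G).index < n
      rw [← hn, ← hcard]
      have h1 : 1 < Nat.card (P : Subgroup G) := hpp.one_lt.trans_le
        (Nat.le_of_dvd Nat.card_pos (P.dvd_card_of_dvd_card (Nat.dvd_of_mem_primeFactors hp)))
      exact lt_mul_of_one_lt_left (Nat.pos_of_ne_zero Subgroup.index_ne_zero_of_finite) h1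
    · change 31 * cyclicPsi (P : Subgroup G).index < _
      rw [psi_of_isCyclic (P : Subgroup G)] at hpsi
      rw [← hcard, cyclicPsi_mul hco] at h
      refine Nat.lt_of_mul_lt_mul_left (a := cyclicPsi (Nat.card (P : Subgroup G))) ?_
      nlinarith
  · push Not at hcase
    have h5 : (Subgroup.zpowers x).index ≤ 5 := by
      by_contra hgt
      have hm : 6 ≤ (Subgroup.zpowers x).index := by omega
      -- With `N` equal to the index `m`, this reads `161 * m < 924`, impossible for `m ≥ 6`.
      have := index_lt_of_psi_gt x hx h _ hm hcase
      omega
    rcases supersolvable_or_of_index_le_five x h5 with hG | ⟨h4, φ, hidx, hS⟩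
    · exact hG
    · have := psi_le_of_index_eq_four x h4 φ hidx hS fun p hp hd => by
        have := hcase p (Nat.mem_primeFactors.2 ⟨hp, hd, Nat.card_pos.ne'⟩)
        rw [h4] at this
        interval_cases p <;> revert hp <;> norm_num
      omega

theorem mainTheorem1 {G : Type*} [Group G] [Finite G] (n : ℕ) (hn : Nat.card G = n)
    (h : (psi G : ℚ) > 31 / 77 * (psi (Multiplicative (ZMod n)) : ℚ)) :
    IsSupersolvable G := by
  have : NeZero n := ⟨hn ▸ Nat.card_pos.ne'⟩
  refine isSupersolvable_of_psi_gt ?_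
  rw [psi_of_isCyclic (Multiplicative (ZMod n)), Nat.card_congr Multiplicative.toAdd,
    Nat.card_zmod] at h
  rw [hn]
  have h' : (31 * cyclicPsi n : ℚ) < 77 * psi G := by linarith
  exact_mod_cast h'
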